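/- All operators below are bounded operators on complex Hilbert spaces, and $f(N)$ denotes the continuous functional calculus of a normal operator $N$. For sets $S,T$, a matrix $a=\{a(s,t)\}_{(s,t)\in S\times T}$ belongs to $\mathfrak B(S\times T)$ if there is a bounded operator $A:\ell^2(T)\to\ell^2(S)$ with $(Ax)_s=\sum_{t\in T}a(s,t)x_t$ for all $x\in\ell^2(T)$, $s\in S$; then $\|a\|:=\|A\|$, and $\|a\|:=\infty$ if there is no such $A$. Write $(\Phi\star a)(s,t)=\Phi(s,t)a(s,t)$. A matrix $\Phi$ on $S\times T$ is a (discrete) Schur multiplier, $\Phi\in\mathfrak M(S\times T)$, if $\Phi\star a\in\mathfrak B(S\times T)$ for every $a\in\mathfrak B(S\times T)$. Put $$\|\Phi\|_{\mathfrak M(S\times T)}=\sup\{\|\Phi\star a\|:\ a\in\mathfrak B(S\times T),\ \|a\|\le 1\},$$ $$\|\Phi\|_{\mathfrak M_0(S\times T)}=\sup\{\|\Phi\star a\|:\ a\in\mathfrak B(S\times T),\ \|a\|\le 1,\ a(t,t)=0\text{ for all }t\in S\cap T\}.$$ For a complex function $f$ put $(\mathfrak D_0f)(z,w)=\dfrac{f(z)-f(w)}{z-w}$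 if $z\ne w$ and $(\mathfrak D_0f)(z,z)=0$. For closed sets $F_1,F_2\subset\mathbb C$, $CL(F_1,F_2)$ is the set of continuous $f:F_1\cup F_2\to\mathbb C$ for which there is $C\ge 0$ such that $$\|f(N_1)R-Rf(N_2)\|\le C\|N_1R-RN_2\|$$ for every Hilbert space $\mathcal H$, every operator $R$ on $\mathcal H$ and all normal operators $N_1,N_2$ on $\mathcal H$ with $\sigma(N_1)\subset F_1$, $\sigma(N_2)\subset F_2$; $\|f\|_{CL(F_1,F_2)}$ is the smallest such $C$, and it is $\infty$ if $f\notin CL(F_1,F_2)$. For a closed set $F\subset\mathbb C$, $CL(F)$ (the commutator Lipschitz functions on $F$) is the set of continuous $f:F\to\mathbb C$ for which there is $C\ge0$ such that $\|f(N)R-Rf(N)\|\le C\|NR-RN\|$ for every Hilbert space $\mathcal H$, every operator $R$ on $\mathcal H$ and every normal operator $N$ on $\mathcal H$ with $\sigma(N)\subset F$; $\|f\|_{CL(F)}$ is the smallest such $C$, and it is $\infty$ if $f\notin CL(F)$. **Theorem.** (1) Let $F_1,F_2$ be closed subsets of $\mathbb C$ and let $f$ be a continuous complex function on $F_1\cup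 F_2$. Then $f\in CL(F_1,F_2)$ if and only if $\mathfrak D_0f\in\mathfrak M(F_1\times F_2)$. Moreover, $$\|f\|_{CL(F_1,F_2)}=\|\mathfrak D_0f\|_{\mathfrak M_0(F_1\times F_2)}\le\|\mathfrak D_0f\|_{\mathfrak M(F_1\times F_2)}\le2\|f\|_{CL(F_1,F_2)}.$$ (2) Let $F$ be a closed subset of $\mathbb C$ and let $f:F\to\mathbb C$ be an arbitrary function. Then $f\in CL(F)$ if and only if $\mathfrak D_0f\in\mathfrak M(F\times F)$, and $$\|f\|_{CL(F)}=\|\mathfrak D_0f\|_{\mathfrak M_0(F\times F)}\le\|\mathfrak D_0f\|_{\mathfrak M(F\times F)}\le2\|f\|_{CL(F)}.$$ (Here the values may be $\infty$.) -/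

import Mathlib

open scoped Matrix ENNReal NNReal lp

universe u

namespace SchurMultiplier

variable {X : Type*} {S T : Set X}

/-- The bounded operator `A : ℓ²(T) → ℓ²(S)` is induced by the matrix `a`:
`(A x)_s = ∑_t a(s,t) x_t` for every `x` in `ℓ²(T)` and every `s`, the series being convergent. -/
def Induces (a : Matrix S T ℂ) (A : ℓ²(T, ℂ) →L[ℂ] ℓ²(S, ℂ)) : Prop :=
  ∀ (x : ℓ²(T, ℂ)) (s : S), HasSum (fun t : T => a s t * x t) (A x s)

/-- The matrix `a` induces a bounded operator from `ℓ²(T)` to `ℓ²(S)`. -/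
def IsBoundedMatrix (a : Matrix S T ℂ) : Prop :=
  ∃ A : ℓ²(T, ℂ) →L[ℂ] ℓ²(S, ℂ), Induces a A

/-- The operator norm of a matrix: the norm of the (unique) bounded operator that it induces,
and `∞` if it induces none. -/
noncomputable def matrixNorm (a : Matrix S T ℂ) : ℝ≥0∞ :=
  ⨅ (A : ℓ²(T, ℂ) →L[ℂ] ℓ²(S, ℂ)) (_ : Induces a A), ‖A‖ₑ

/-- `Φ` is a (discrete) Schur multiplier: the entrywise product `Φ ⊙ a` induces a bounded operator
whenever `a` does. -/
def IsSchurMultiplier (Φ : Matrix S T ℂ) : Prop :=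
  ∀ a : Matrix S T ℂ, IsBoundedMatrix a → IsBoundedMatrix (Φ ⊙ a)

/-- The Schur multiplier norm `‖Φ‖_𝔐`. -/
noncomputable def multiplierNorm (Φ : Matrix S T ℂ) : ℝ≥0∞ :=
  ⨆ (a : Matrix S T ℂ) (_ : IsBoundedMatrix a ∧ matrixNorm a ≤ 1), matrixNorm (Φ ⊙ a)

/-- The norm `‖Φ‖_𝔐₀`: as `‖Φ‖_𝔐`, but testing only on matrices `a` with
`a(t,t) = 0` for every `t ∈ S ∩ T`. -/
noncomputable def multiplierNorm₀ (Φ : Matrix S T ℂ) : ℝ≥0∞ :=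
  ⨆ (a : Matrix S T ℂ) (_ : IsBoundedMatrix a ∧ matrixNorm a ≤ 1 ∧
      ∀ (s : S) (t : T), (s : X) = (t : X) → a s t = 0), matrixNorm (Φ ⊙ a)

end SchurMultiplier

namespace CommutatorLipschitz

open Classical in
/-- The divided difference `𝔇₀ f`, equal to `0` on the diagonal, as a matrix on `F₁ × F₂`. -/
noncomputable def dividedDifference₀ (f : ℂ → ℂ) (F₁ F₂ : Set ℂ) : Matrix F₁ F₂ ℂ :=
  Matrix.of fun z w => if (z : ℂ) = (w : ℂ) then 0 else (f z - f w) / ((z : ℂ) - (w : ℂ))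

/-- `‖f(N₁) R - R f(N₂)‖ ≤ C ‖N₁ R - R N₂‖` for all bounded operators `R` and all bounded normal
operators `N₁`, `N₂` on a complex Hilbert space with spectra in `F₁` and `F₂`. -/
def PairBound (F₁ F₂ : Set ℂ) (f : ℂ → ℂ) (C : ℝ≥0) : Prop :=
  ∀ (H : Type u) [NormedAddCommGroup H] [InnerProductSpace ℂ H] [CompleteSpace H]
    (N₁ N₂ R : H →L[ℂ] H), IsStarNormal N₁ → IsStarNormal N₂ →
    spectrum ℂ N₁ ⊆ F₁ → spectrum ℂ N₂ ⊆ F₂ →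
    ‖cfc f N₁ * R - R * cfc f N₂‖ ≤ C * ‖N₁ * R - R * N₂‖

/-- The class `CL(F₁, F₂)`. Only the values of `f` on `F₁ ∪ F₂` matter. -/
def IsCommLipPair (F₁ F₂ : Set ℂ) (f : ℂ → ℂ) : Prop :=
  ContinuousOn f (F₁ ∪ F₂) ∧ ∃ C : ℝ≥0, PairBound.{u} F₁ F₂ f C

/-- `‖f‖_{CL(F₁, F₂)}`: the smallest admissible constant, and `∞` if `f` is not in
`CL(F₁, F₂)`. -/
noncomputable def pairNorm (F₁ F₂ : Set ℂ) (f : ℂ → ℂ) : ℝ≥0∞ :=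
  ⨅ (C : ℝ≥0) (_ : ContinuousOn f (F₁ ∪ F₂) ∧ PairBound.{u} F₁ F₂ f C), (C : ℝ≥0∞)

/-- `‖f(N) R - R f(N)‖ ≤ C ‖N R - R N‖` for all bounded operators `R` and all bounded normal
operators `N` on a complex Hilbert space with spectrum in `F`. -/
def CommutatorBound (F : Set ℂ) (f : ℂ → ℂ) (C : ℝ≥0) : Prop :=
  ∀ (H : Type u) [NormedAddCommGroup H] [InnerProductSpace ℂ H] [CompleteSpace H]
    (N R : H →L[ℂ] H), IsStarNormal N → spectrum ℂ N ⊆ F →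
    ‖cfc f N * R - R * cfc f N‖ ≤ C * ‖N * R - R * N‖

/-- The class `CL(F)` of commutator Lipschitz functions on `F`. Only the values of `f` on `F`
matter. -/
def IsCommLip (F : Set ℂ) (f : ℂ → ℂ) : Prop :=
  ContinuousOn f F ∧ ∃ C : ℝ≥0, CommutatorBound.{u} F f C

/-- `‖f‖_{CL(F)}`: the smallest admissible constant, and `∞` if `f` is not in `CL(F)`. -/
noncomputable def commNorm (F : Set ℂ) (f : ℂ → ℂ) : ℝ≥0∞ :=
  ⨅ (C : ℝ≥0) (_ : ContinuousOn f F ∧ CommutatorBound.{u} F f C), (C : ℝ≥0∞)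

end CommutatorLipschitz

/-!
The norms of `CL(F₁, F₂)`, `CL(F)` and `𝔐₀` are infima of admissible constants, so everything
reduces to one equivalence: a constant `C` bounds the commutators for `f` if and only if
`‖𝔇₀ f ⊙ a‖ ≤ C ‖a‖` for every bounded matrix `a` that vanishes on the diagonal
(`OffDiagonalBound`).

*From commutators to matrices.* For diagonal operators `N₁`, `N₂` the entries of `N₁ R - R N₂` and
`f(N₁) R - R f(N₂)` are `(s - t) r(s, t)` and `(f s - f t) r(s, t)`, so the second matrix is the
Schur product of `𝔇₀ f` with the first, and a matrix vanishing on the diagonal is always of the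
form `(s - t) r(s, t)`. Only finite sections are treated this way
(`offDiagonalBound_of_diagonalBound`), as `r` may be unbounded; uniformly bounded finite sections
come from a bounded operator (`exists_induces_of_finite_bound`).

*From matrices to commutators.* No spectral measure is needed. Given a vector `x` and a normal
operator `N`, take a continuous partition of unity `∑ g_t² = 1` on the spectrum with small supports
around points `t`. The column `y ↦ (g_t(N) y)_t` is an isometry that almost intertwines `N` with the
diagonal operator with entries `t`, and likewise `f(N)` with the one with entries `f t`. Restricting
its adjoint to multiples of the unit vectors in the directions of `g_t(N) x` gives a contraction
`ℓ²(F) → H` whose range contains `x` (`exists_almost_intertwining`). Compressing the commutators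
with two such contractions produces scalar matrices `(s - t) ρ(s, t)` and `(f s - f t) ρ(s, t)`, to
which the multiplier bound applies; the error tends to `0` with the supports
(`norm_inner_commutator_le`).

The factor `2` comes from removing the diagonal of a matrix, which at most doubles its norm. That a
Schur multiplier is bounded at all is the closed graph theorem
(`IsSchurMultiplier.exists_offDiagonalBound`). In the statement about one set, `f` is
continuous because the entries of `𝔇₀ f` are bounded, which makes `f` Lipschitz.
-/

/-! ### Matrices of bounded operators between `ℓ²` spaces -/

namespace SchurMultiplier

open Filter Topology

variable {X : Type*} {S T : Set X}

theorem sum_sq_le_norm_sq {ι : Type*} (x : ℓ²(ι, ℂ)) (P : Finset ι) :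
    ∑ i ∈ P, ‖x i‖ ^ 2 ≤ ‖x‖ ^ 2 := by
  have h := lp.sum_rpow_le_norm_rpow (p := 2) (by norm_num) x P
  simpa using h

theorem norm_sq_sum_single {ι : Type*} [DecidableEq ι] (x : ι → ℂ) (P : Finset ι) :
    ‖(∑ i ∈ P, lp.single 2 i (x i) : ℓ²(ι, ℂ))‖ ^ 2 = ∑ i ∈ P, ‖x i‖ ^ 2 := by
  have h := lp.norm_sum_single (E := fun _ : ι => ℂ) (p := 2) (by norm_num) x P
  simpa using h

theorem coeFn_sum_single_of_mem {ι : Type*} [DecidableEq ι] (x : ι → ℂ) {P : Finset ι} {j : ι}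
    (hj : j ∈ P) : (∑ i ∈ P, lp.single 2 i (x i) : ℓ²(ι, ℂ)) j = x j := by
  rw [lp.coeFn_sum, Finset.sum_apply]
  simp [lp.single_apply, Pi.single_apply, hj]

open Classical in
theorem Induces.apply_sum_single {a : Matrix S T ℂ} {A : ℓ²(T, ℂ) →L[ℂ] ℓ²(S, ℂ)}
    (h : Induces a A) (x : T → ℂ) (Q : Finset T) (s : S) :
    A (∑ t ∈ Q, lp.single 2 t (x t)) s = ∑ t ∈ Q, a s t * x t := by
  refine (h _ s).unique ?_
  have hQ : ∑ t ∈ Q, a s t * x t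
      = ∑ t ∈ Q, a s t * (∑ t ∈ Q, lp.single 2 t (x t) : ℓ²(T, ℂ)) t :=
    Finset.sum_congr rfl fun t ht => by rw [coeFn_sum_single_of_mem x ht]
  rw [hQ]
  refine hasSum_sum_of_ne_finset_zero fun t ht => ?_
  rw [lp.coeFn_sum, Finset.sum_apply]
  simp [lp.single_apply, Pi.single_apply, ht]

open Classical in
theorem Induces.apply_single {a : Matrix S T ℂ} {A : ℓ²(T, ℂ) →L[ℂ] ℓ²(S, ℂ)}
    (h : Induces a A) (t : T) (s : S) : A (lp.single 2 t 1) s = a s t := by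
  simpa using h.apply_sum_single (fun _ => 1) {t} s

theorem Induces.matrix_unique {a b : Matrix S T ℂ} {A : ℓ²(T, ℂ) →L[ℂ] ℓ²(S, ℂ)}
    (ha : Induces a A) (hb : Induces b A) : a = b := by
  ext s t
  rw [← ha.apply_single, hb.apply_single]

theorem Induces.unique {a : Matrix S T ℂ} {A B : ℓ²(T, ℂ) →L[ℂ] ℓ²(S, ℂ)}
    (hA : Induces a A) (hB : Induces a B) : A = B := by
  ext x s
  exact (hA x s).unique (hB x s)

theorem Induces.matrixNorm_eq {a : Matrix S T ℂ} {A : ℓ²(T, ℂ) →L[ℂ] ℓ²(S, ℂ)}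
    (h : Induces a A) : matrixNorm a = ‖A‖ₑ :=
  le_antisymm (iInf₂_le A h) (le_iInf₂ fun B hB => by rw [h.unique hB])

theorem matrixNorm_le_iff {a : Matrix S T ℂ} {C : ℝ≥0} :
    matrixNorm a ≤ C ↔ ∃ A : ℓ²(T, ℂ) →L[ℂ] ℓ²(S, ℂ), Induces a A ∧ ‖A‖ ≤ C := by
  constructor
  · intro h
    by_cases hb : IsBoundedMatrix a
    · obtain ⟨A, hA⟩ := hb
      rw [hA.matrixNorm_eq] at h
      exact ⟨A, hA, by simpa [enorm_le_coe, ← NNReal.coe_le_coe] using h⟩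
    · have : matrixNorm a = ⊤ := by
        simp only [matrixNorm, iInf_eq_top]
        exact fun A hA => absurd ⟨A, hA⟩ hb
      simp [this] at h
  · rintro ⟨A, hA, hC⟩
    rw [hA.matrixNorm_eq, enorm_le_coe]
    exact_mod_cast hC

open Classical in
/-- Every bounded operator between `ℓ²` spaces is induced by its matrix in the standard bases. -/
theorem induces_matrix (A : ℓ²(T, ℂ) →L[ℂ] ℓ²(S, ℂ)) :
    Induces (Matrix.of fun s t => A (lp.single 2 t 1) s) A := by
  intro x s
  have h := (lp.hasSum_single (E := fun _ : T => ℂ) (p := 2) (by norm_num) x).mapL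
    ((lp.evalCLM ℂ (fun _ : S => ℂ) 2 s).comp A)
  have hx : (fun t => A (lp.single 2 t (x t)) s) = fun t => A (lp.single 2 t 1) s * x t := by
    ext t
    have : (lp.single 2 t (x t) : ℓ²(T, ℂ)) = x t • lp.single 2 t 1 := by
      rw [← lp.single_smul]; simp
    rw [this, map_smul, mul_comm]
    rfl
  exact hx ▸ h

theorem Induces.smul {a : Matrix S T ℂ} {A : ℓ²(T, ℂ) →L[ℂ] ℓ²(S, ℂ)} (h : Induces a A) (c : ℂ) :
    Induces (c • a) (c • A) := fun x s => by
  simpa [mul_assoc] using (h x s).mul_left c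

theorem Induces.add {a b : Matrix S T ℂ} {A B : ℓ²(T, ℂ) →L[ℂ] ℓ²(S, ℂ)} (hA : Induces a A)
    (hB : Induces b B) : Induces (a + b) (A + B) := fun x s => by
  simpa [add_mul] using (hA x s).add (hB x s)

theorem Induces.sub {a b : Matrix S T ℂ} {A B : ℓ²(T, ℂ) →L[ℂ] ℓ²(S, ℂ)} (hA : Induces a A)
    (hB : Induces b B) : Induces (a - b) (A - B) := fun x s => by
  simpa [sub_mul] using (hA x s).sub (hB x s)

/-- A matrix whose finite sections are uniformly bounded by `C` induces a bounded operator of norm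
at most `C`: its rows are square summable, so it acts on `ℓ²` by convergent series, and the bound
passes to the limit. -/
theorem exists_induces_of_finite_bound {a : Matrix S T ℂ} {C : ℝ≥0}
    (h : ∀ (P : Finset S) (Q : Finset T) (x : T → ℂ),
      ∑ s ∈ P, ‖∑ t ∈ Q, a s t * x t‖ ^ 2 ≤ C ^ 2 * ∑ t ∈ Q, ‖x t‖ ^ 2) :
    ∃ A : ℓ²(T, ℂ) →L[ℂ] ℓ²(S, ℂ), Induces a A ∧ ‖A‖ ≤ C := by
  have hrow (s : S) (Q : Finset T) : ∑ t ∈ Q, ‖a s t‖ ^ 2 ≤ (C : ℝ) ^ 2 := by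
    -- test the bound on the conjugate of the row itself
    have h1 := h {s} Q fun t => star (a s t)
    set K := ∑ t ∈ Q, ‖a s t‖ ^ 2 with hK
    have h2 : ∑ t ∈ Q, a s t * star (a s t) = (K : ℂ) := by
      simp [hK, Complex.mul_conj, Complex.normSq_eq_norm_sq]
    have hK0 : 0 ≤ K := Finset.sum_nonneg fun _ _ => by positivity
    simp only [Finset.sum_singleton, h2, norm_star, ← hK, Complex.norm_real] at h1
    rw [Real.norm_of_nonneg hK0] at h1
    rcases hK0.eq_or_lt with h0 | h0
    · rw [← h0]; positivity
    · nlinarith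
  have hmem (s : S) : Memℓp (fun t => star (a s t)) 2 :=
    memℓp_gen' (C := (C : ℝ) ^ 2) fun Q => by simpa using hrow s Q
  have hsum (x : ℓ²(T, ℂ)) (s : S) : Summable fun t => a s t * x t := by
    simpa [mul_comm] using lp.summable_inner (𝕜 := ℂ) (⟨_, hmem s⟩ : ℓ²(T, ℂ)) x
  have hbound (x : ℓ²(T, ℂ)) (P : Finset S) :
      ∑ s ∈ P, ‖∑' t, a s t * x t‖ ^ 2 ≤ (C * ‖x‖) ^ 2 := by
    refine le_of_tendsto (tendsto_finsetSum P fun s _ => ((hsum x s).hasSum.norm.pow 2))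
      (Eventually.of_forall fun Q => ?_)
    refine (h P Q x).trans ?_
    rw [mul_pow]
    gcongr
    exact sum_sq_le_norm_sq x Q
  let L : ℓ²(T, ℂ) →ₗ[ℂ] ℓ²(S, ℂ) :=
    { toFun := fun x => ⟨fun s => ∑' t, a s t * x t,
        memℓp_gen' (C := (C * ‖x‖) ^ 2) fun P => by simpa using hbound x P⟩
      map_add' := fun x y => by
        ext s
        simp only [lp.coeFn_add, Pi.add_apply, mul_add]
        exact (hsum x s).tsum_add (hsum y s)
      map_smul' := fun c x => by
        ext s
        simp only [lp.coeFn_smul, Pi.smul_apply, smul_eq_mul, RingHom.id_apply, mul_left_comm _ c]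
        exact tsum_mul_left }
  have hL (x : ℓ²(T, ℂ)) : ‖L x‖ ≤ C * ‖x‖ :=
    lp.norm_le_of_forall_sum_le (p := 2) (by norm_num) (by positivity) fun P => by
      have := hbound x P
      simp only [ENNReal.toReal_ofNat, Real.rpow_ofNat]
      exact this
  exact ⟨L.mkContinuous C hL, fun x s => (hsum x s).hasSum,
    L.mkContinuous_norm_le C.coe_nonneg hL⟩

open Classical in
/-- The part of a bounded matrix supported on `{(s, t) | s = t}` is bounded by the norm of the
whole matrix, as it acts on `ℓ²` by multiplication by entries. -/
theorem Induces.exists_diagonal {a : Matrix S T ℂ} {A : ℓ²(T, ℂ) →L[ℂ] ℓ²(S, ℂ)}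
    (h : Induces a A) :
    ∃ D : ℓ²(T, ℂ) →L[ℂ] ℓ²(S, ℂ),
      Induces (Matrix.of fun s t => if (s : X) = t then a s t else 0) D ∧ ‖D‖ ≤ ‖A‖ := by
  have hentry (s : S) (t : T) : ‖a s t‖ ≤ ‖A‖ := by
    rw [← h.apply_single]
    refine (lp.norm_apply_le_norm (by norm_num) _ s).trans ((A.le_opNorm _).trans ?_)
    rw [lp.norm_single (by norm_num)]
    simp
  refine exists_induces_of_finite_bound (C := ‖A‖₊) fun P Q x => ?_
  have h1 (s : S) : ‖∑ t ∈ Q, (Matrix.of fun (s : S) (t : T) =>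
      if (s : X) = t then a s t else 0) s t * x t‖ ^ 2
      ≤ ∑ t ∈ Q, if (s : X) = t then ‖A‖ ^ 2 * ‖x t‖ ^ 2 else 0 := by
    simp only [Matrix.of_apply, ite_mul, zero_mul]
    by_cases hs : ∃ t ∈ Q, (s : X) = t
    · obtain ⟨t, ht, hst⟩ := hs
      have ht' (t' : T) : (s : X) = t' ↔ t = t' := by rw [hst, Subtype.ext_iff]
      simp only [ht', Finset.sum_ite_eq, ht, if_true, norm_mul, mul_pow]
      gcongr
      exact hentry s t
    · push Not at hs
      rw [Finset.sum_eq_zero fun t ht => if_neg (hs t ht),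
        Finset.sum_eq_zero fun t ht => if_neg (hs t ht)]
      simp
  refine (Finset.sum_le_sum fun s _ => h1 s).trans ?_
  rw [Finset.sum_comm, Finset.mul_sum]
  refine Finset.sum_le_sum fun t _ => ?_
  by_cases ht : ∃ s ∈ P, (s : X) = t
  · obtain ⟨s, hs, hst⟩ := ht
    have ht' (s' : S) : (s' : X) = t ↔ s' = s := by rw [← hst, Subtype.ext_iff]
    simp [ht', hs]
  · push Not at ht
    rw [Finset.sum_eq_zero fun s hs => if_neg (ht s hs)]
    positivity

/-! ### Norms of Schur multipliers -/

/-- `Φ ⊙ a` is bounded with norm at most `C ‖a‖` for every bounded matrix `a` vanishing on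
`{(s, t) | s = t}`. -/
def OffDiagonalBound (Φ : Matrix S T ℂ) (C : ℝ≥0) : Prop :=
  ∀ (a : Matrix S T ℂ) (A : ℓ²(T, ℂ) →L[ℂ] ℓ²(S, ℂ)), Induces a A →
    (∀ (s : S) (t : T), (s : X) = (t : X) → a s t = 0) →
    ∃ B : ℓ²(T, ℂ) →L[ℂ] ℓ²(S, ℂ), Induces (Φ ⊙ a) B ∧ ‖B‖ ≤ C * ‖A‖

theorem multiplierNorm₀_le_iff {Φ : Matrix S T ℂ} {C : ℝ≥0} :
    multiplierNorm₀ Φ ≤ C ↔ OffDiagonalBound Φ C := by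
  simp only [multiplierNorm₀, iSup_le_iff]
  constructor
  · intro h a A hA h0
    rcases eq_or_ne A 0 with rfl | hne
    · have ha : a = 0 := by
        ext s t
        rw [← hA.apply_single]
        simp
      exact ⟨0, by simpa [ha] using hA, by simp⟩
    have hn : 0 < ‖A‖ := norm_pos_iff.2 hne
    have hc := hA.smul ((‖A‖⁻¹ : ℝ) : ℂ)
    obtain ⟨B, hB, hBC⟩ := matrixNorm_le_iff.1 <| h (((‖A‖⁻¹ : ℝ) : ℂ) • a)
      ⟨⟨_, hc⟩, (matrixNorm_le_iff (C := 1)).2 ⟨_, hc, by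
        rw [norm_smul, Complex.norm_real, norm_inv, norm_norm, inv_mul_cancel₀ hn.ne']; simp⟩,
        fun s t hst => by simp [h0 s t hst]⟩
    refine ⟨(‖A‖ : ℂ) • B, ?_, ?_⟩
    · convert hB.smul (‖A‖ : ℂ) using 1
      ext s t
      have : (‖A‖ : ℂ) ≠ 0 := by exact_mod_cast hn.ne'
      simp
      field_simp
    · rw [norm_smul, Complex.norm_real, norm_norm, mul_comm]
      gcongr
  · rintro h a ⟨⟨A, hA⟩, ha1, h0⟩
    obtain ⟨B, hB, hBC⟩ := h a A hA h0
    rw [hA.matrixNorm_eq] at ha1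
    have : ‖A‖ ≤ 1 := (enorm_le_coe (r := 1)).1 ha1
    exact matrixNorm_le_iff.2 ⟨B, hB, hBC.trans (mul_le_of_le_one_right C.coe_nonneg this)⟩

theorem multiplierNorm₀_le_multiplierNorm (Φ : Matrix S T ℂ) :
    multiplierNorm₀ Φ ≤ multiplierNorm Φ :=
  iSup_le fun a => iSup_le fun ha => le_iSup₂_of_le a ⟨ha.1, ha.2.1⟩ le_rfl

/-- If `Φ` vanishes on `{(s, t) | s = t}`, then `Φ ⊙ a` does not see that part of `a`, and removing
it at most doubles the norm of `a`. -/
theorem OffDiagonalBound.exists_induces {Φ : Matrix S T ℂ} {C : ℝ≥0} (h : OffDiagonalBound Φ C)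
    (hΦ : ∀ (s : S) (t : T), (s : X) = (t : X) → Φ s t = 0) {a : Matrix S T ℂ}
    {A : ℓ²(T, ℂ) →L[ℂ] ℓ²(S, ℂ)} (hA : Induces a A) :
    ∃ B : ℓ²(T, ℂ) →L[ℂ] ℓ²(S, ℂ), Induces (Φ ⊙ a) B ∧ ‖B‖ ≤ 2 * C * ‖A‖ := by
  obtain ⟨D, hD, hDA⟩ := hA.exists_diagonal
  obtain ⟨B, hB, hBC⟩ := h _ _ (hA.sub hD) fun s t hst => by simp [hst]
  refine ⟨B, ?_, hBC.trans ?_⟩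
  · convert hB using 1
    ext s t
    by_cases hst : (s : X) = t
    · simp [hΦ s t hst]
    · simp [hst]
  · have := norm_sub_le A D
    have hC := C.coe_nonneg
    nlinarith

theorem OffDiagonalBound.isSchurMultiplier {Φ : Matrix S T ℂ} {C : ℝ≥0}
    (h : OffDiagonalBound Φ C) (hΦ : ∀ (s : S) (t : T), (s : X) = (t : X) → Φ s t = 0) :
    IsSchurMultiplier Φ := by
  rintro a ⟨A, hA⟩
  obtain ⟨B, hB, -⟩ := h.exists_induces hΦ hA
  exact ⟨B, hB⟩

theorem multiplierNorm_le_two_mul {Φ : Matrix S T ℂ}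
    (hΦ : ∀ (s : S) (t : T), (s : X) = (t : X) → Φ s t = 0) :
    multiplierNorm Φ ≤ 2 * multiplierNorm₀ Φ := by
  rcases eq_or_ne (multiplierNorm₀ Φ) ⊤ with htop | htop
  · simp [htop]
  lift multiplierNorm₀ Φ to ℝ≥0 using htop with C hC
  have h := multiplierNorm₀_le_iff.1 hC.ge
  refine iSup₂_le fun a => ?_
  rintro ⟨⟨A, hA⟩, ha1⟩
  obtain ⟨B, hB, hBC⟩ := h.exists_induces hΦ hA
  rw [hA.matrixNorm_eq] at ha1
  have : ‖A‖ ≤ 1 := (enorm_le_coe (r := 1)).1 ha1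
  exact_mod_cast (matrixNorm_le_iff (C := 2 * C)).2
    ⟨B, hB, hBC.trans (mul_le_of_le_one_right (by positivity) (by simpa using this))⟩

/-- A Schur multiplier acts boundedly on bounded matrices, by the closed graph theorem. -/
theorem IsSchurMultiplier.exists_offDiagonalBound {Φ : Matrix S T ℂ} (h : IsSchurMultiplier Φ) :
    ∃ C : ℝ≥0, OffDiagonalBound Φ C := by
  classical
  choose G hG using fun A : ℓ²(T, ℂ) →L[ℂ] ℓ²(S, ℂ) => h _ ⟨A, induces_matrix A⟩
  let L : (ℓ²(T, ℂ) →L[ℂ] ℓ²(S, ℂ)) →ₗ[ℂ] (ℓ²(T, ℂ) →L[ℂ] ℓ²(S, ℂ)) :=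
    { toFun := G
      map_add' := fun A B => (hG (A + B)).unique <| by
        convert (hG A).add (hG B) using 1
        ext s t
        simp [Matrix.hadamard_apply, mul_add]
      map_smul' := fun c A => (hG (c • A)).unique (B := c • G A) <| by
        convert (hG A).smul c using 1
        ext s t
        simp [Matrix.hadamard_apply, mul_left_comm] }
  have hgraph : ∀ (U : ℕ → ℓ²(T, ℂ) →L[ℂ] ℓ²(S, ℂ)) (A B : ℓ²(T, ℂ) →L[ℂ] ℓ²(S, ℂ)),
      Tendsto U atTop (𝓝 A) → Tendsto (L ∘ U) atTop (𝓝 B) → B = L A := by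
    intro U A B hU hLU
    have hcont (s : S) (t : T) : Continuous fun A : ℓ²(T, ℂ) →L[ℂ] ℓ²(S, ℂ) =>
        A (lp.single 2 t 1) s :=
      (lp.evalCLM ℂ (fun _ : S => ℂ) 2 s).continuous.comp
        (ContinuousLinearMap.apply ℂ ℓ²(S, ℂ) (lp.single 2 t 1 : ℓ²(T, ℂ))).continuous
    have hB : (Matrix.of fun s t => B (lp.single 2 t 1) s)
        = Φ ⊙ Matrix.of fun s t => A (lp.single 2 t 1) s := by
      ext s t
      refine tendsto_nhds_unique (((hcont s t).tendsto B).comp hLU) ?_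
      refine ((((hcont s t).tendsto A).comp hU).const_mul (Φ s t)).congr fun n => ?_
      exact ((hG (U n)).apply_single t s).symm
    exact (induces_matrix B).unique (hB ▸ hG A)
  refine ⟨‖ContinuousLinearMap.ofSeqClosedGraph hgraph‖₊, fun a A hA _ => ⟨G A, ?_, ?_⟩⟩
  · rw [hA.matrix_unique (induces_matrix A)]
    exact hG A
  · exact (ContinuousLinearMap.ofSeqClosedGraph hgraph).le_opNorm A

theorem OffDiagonalBound.norm_apply_le {Φ : Matrix S T ℂ} {C : ℝ≥0} (h : OffDiagonalBound Φ C)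
    {s : S} {t : T} (hst : (s : X) ≠ t) : ‖Φ s t‖ ≤ C := by
  classical
  -- test on the matrix unit at `(s, t)`
  have hE : Induces (Matrix.single s t 1) ((lp.singleContinuousLinearMap ℂ (fun _ : S => ℂ) 2 s).comp
      (lp.evalCLM ℂ (fun _ : T => ℂ) 2 t)) := by
    intro x s'
    have : ∀ t' ≠ t, (Matrix.single s t 1 : Matrix S T ℂ) s' t' * x t' = 0 := fun t' ht' => by
      simp [ht'.symm]
    convert hasSum_single t this using 1
    by_cases hs : s = s'
    · subst hs
      simp [lp.single_apply]
      rfl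
    · simp [hs, lp.single_apply, Ne.symm hs]
  obtain ⟨B, hB, hBC⟩ := h _ _ hE fun s' t' hs' => by
    rw [Matrix.single_apply, if_neg]
    rintro ⟨rfl, rfl⟩
    exact hst hs'
  have h1 : ‖B (lp.single 2 t 1) s‖ ≤ ‖B‖ := by
    refine (lp.norm_apply_le_norm (by norm_num) _ s).trans ((B.le_opNorm _).trans ?_)
    rw [lp.norm_single (by norm_num)]
    simp
  have h2 : ‖(lp.singleContinuousLinearMap ℂ (fun _ : S => ℂ) 2 s).comp
      (lp.evalCLM ℂ (fun _ : T => ℂ) 2 t)‖ ≤ 1 := by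
    refine ContinuousLinearMap.opNorm_le_bound _ zero_le_one fun x => ?_
    rw [ContinuousLinearMap.comp_apply, lp.singleContinuousLinearMap_apply,
      lp.norm_single (by norm_num), one_mul]
    exact lp.norm_apply_le_norm (by norm_num) x t
  rw [hB.apply_single] at h1
  have := h1.trans (hBC.trans (mul_le_of_le_one_right C.coe_nonneg h2))
  simpa using this

end SchurMultiplier

/-! ### Commutator estimates for diagonal operators -/

namespace CommutatorLipschitz

open SchurMultiplier

section Diagonal

variable {ι : Type*} [Fintype ι] [DecidableEq ι]

/-- The diagonal operators on a finite-dimensional Euclidean space, as a representation of the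
algebra of their diagonals. -/
noncomputable def diagonalOperator :
    (ι → ℂ) →⋆ₐ[ℂ] (EuclideanSpace ℂ ι →L[ℂ] EuclideanSpace ℂ ι) :=
  (Matrix.toEuclideanCLM (𝕜 := ℂ) (n := ι)).toStarAlgHom.comp
    { Matrix.diagonalAlgHom ℂ with
      map_star' := fun p => by simp [Matrix.star_eq_conjTranspose] }

theorem diagonalOperator_apply (p : ι → ℂ) :
    diagonalOperator p = Matrix.toEuclideanCLM (𝕜 := ℂ) (Matrix.diagonal p) := rfl

theorem spectrum_diagonalOperator_subset (p : ι → ℂ) :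
    spectrum ℂ (diagonalOperator p) ⊆ Set.range p := by
  refine (AlgHom.spectrum_apply_subset diagonalOperator p).trans ?_
  rw [Pi.spectrum_eq]
  refine Set.iUnion_subset fun i z hz => ⟨i, ?_⟩
  simpa [spectrum.mem_iff, sub_eq_zero, eq_comm] using hz

theorem isStarNormal_diagonalOperator (p : ι → ℂ) : IsStarNormal (diagonalOperator p) :=
  ⟨by rw [← map_star]; exact (Commute.all (star p) p).map diagonalOperator⟩

theorem cfc_diagonalOperator (f : ℂ → ℂ) (p : ι → ℂ) :
    cfc f (diagonalOperator p) = diagonalOperator (f ∘ p) := by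
  have hfin : (⋃ i, spectrum ℂ (p i)).Finite :=
    Set.finite_iUnion fun i => by
      refine (Set.finite_singleton (p i)).subset fun z hz => ?_
      simpa [spectrum.mem_iff, sub_eq_zero, eq_comm] using hz
  have hcont : ContinuousOn f (⋃ i, spectrum ℂ (p i)) := hfin.continuousOn f
  have hcfc : cfc f p = f ∘ p := by
    rw [cfc_map_pi (S := ℂ) (p := IsStarNormal) (q := fun _ => IsStarNormal) f p hcont inferInstance
      fun i => inferInstance]
    ext i
    exact cfc_algebraMap (A := ℂ) (p i) f
  rw [← hcfc]
  symm
  refine StarAlgHom.map_cfc (S := ℂ) diagonalOperator f p ?_ ?_ inferInstance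
    (isStarNormal_diagonalOperator p)
  · rwa [Pi.spectrum_eq]
  · exact (diagonalOperator (ι := ι)).toAlgHom.toLinearMap.continuous_of_finiteDimensional

theorem diagonalOperator_commutator (p q : ι → ℂ) (r : Matrix ι ι ℂ) :
    diagonalOperator p * Matrix.toEuclideanCLM (𝕜 := ℂ) r
        - Matrix.toEuclideanCLM (𝕜 := ℂ) r * diagonalOperator q
      = Matrix.toEuclideanCLM (𝕜 := ℂ) (Matrix.of fun i j => (p i - q j) * r i j) := by
  rw [diagonalOperator_apply, diagonalOperator_apply, ← map_mul, ← map_mul, ← map_sub]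
  congr 1
  ext i j
  simp [mul_comm (r i j), sub_mul]

/-- The commutator estimate for the diagonal operators with diagonals `p` and `q`. -/
def DiagonalBound (f : ℂ → ℂ) (C : ℝ≥0) (p q : ι → ℂ) : Prop :=
  ∀ r : Matrix ι ι ℂ,
    ‖Matrix.toEuclideanCLM (𝕜 := ℂ) (Matrix.of fun i j => (f (p i) - f (q j)) * r i j)‖
      ≤ C * ‖Matrix.toEuclideanCLM (𝕜 := ℂ) (Matrix.of fun i j => (p i - q j) * r i j)‖

end Diagonal

theorem PairBound.diagonalBound {F₁ F₂ : Set ℂ} {f : ℂ → ℂ} {C : ℝ≥0}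
    (h : PairBound.{u} F₁ F₂ f C) {ι : Type u} [Fintype ι] [DecidableEq ι] {p q : ι → ℂ}
    (hp : ∀ i, p i ∈ F₁) (hq : ∀ i, q i ∈ F₂) : DiagonalBound f C p q := fun r => by
  have := h (EuclideanSpace ℂ ι) (diagonalOperator p) (diagonalOperator q)
    (Matrix.toEuclideanCLM (𝕜 := ℂ) r)
    (isStarNormal_diagonalOperator p) (isStarNormal_diagonalOperator q)
    ((spectrum_diagonalOperator_subset p).trans (Set.range_subset_iff.2 hp))
    ((spectrum_diagonalOperator_subset q).trans (Set.range_subset_iff.2 hq))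
  rwa [cfc_diagonalOperator, cfc_diagonalOperator, diagonalOperator_commutator,
    diagonalOperator_commutator] at this

theorem CommutatorBound.diagonalBound {F : Set ℂ} {f : ℂ → ℂ} {C : ℝ≥0}
    (h : CommutatorBound.{u} F f C) {ι : Type u} [Fintype ι] [DecidableEq ι] {p : ι → ℂ}
    (hp : ∀ i, p i ∈ F) : DiagonalBound f C p p := fun r => by
  have := h (EuclideanSpace ℂ ι) (diagonalOperator p) (Matrix.toEuclideanCLM (𝕜 := ℂ) r)
    (isStarNormal_diagonalOperator p)
    ((spectrum_diagonalOperator_subset p).trans (Set.range_subset_iff.2 hp))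
  rwa [cfc_diagonalOperator, diagonalOperator_commutator,
    diagonalOperator_commutator] at this

theorem dividedDifference₀_of_eq {F₁ F₂ : Set ℂ} (f : ℂ → ℂ) (s : F₁) (t : F₂)
    (h : (s : ℂ) = t) : dividedDifference₀ f F₁ F₂ s t = 0 := by
  simp [dividedDifference₀, h]

theorem dividedDifference₀_mul_sub {F₁ F₂ : Set ℂ} (f : ℂ → ℂ) (s : F₁) (t : F₂) :
    dividedDifference₀ f F₁ F₂ s t * ((s : ℂ) - t) = f s - f t := by
  by_cases h : (s : ℂ) = t
  · simp [h]
  · simp [dividedDifference₀, h, sub_ne_zero.2 h]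

/-- If the commutator estimate holds for diagonal operators, it bounds the Schur multiplier
`𝔇₀ f`: a finite section `P × Q` of a matrix `a` vanishing on the diagonal is an off-diagonal block
of the commutator of diagonal operators with the matrix `a(s, t) / (s - t)`. The hypothesis leaves
`p` free on `Q` and `q` free on `P`, so that it covers both a pair of operators with spectra in
`F₁` and `F₂` and a single operator with spectrum in `F₁ = F₂`. -/
theorem offDiagonalBound_of_diagonalBound {F₁ F₂ : Set ℂ} {f : ℂ → ℂ} {C : ℝ≥0}
    (h : ∀ (P : Finset F₁) (Q : Finset F₂), P.Nonempty → Q.Nonempty →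
      ∃ p q : ULift.{u} (P ⊕ Q) → ℂ, (∀ s, p ⟨.inl s⟩ = (s : F₁)) ∧ (∀ t, q ⟨.inr t⟩ = (t : F₂)) ∧
        DiagonalBound f C p q) :
    OffDiagonalBound (dividedDifference₀ f F₁ F₂) C := by
  classical
  intro a A hA h0
  refine exists_induces_of_finite_bound (C := C * ‖A‖₊) fun P Q x => ?_
  rcases P.eq_empty_or_nonempty with rfl | hP
  · simp only [Finset.sum_empty]; positivity
  rcases Q.eq_empty_or_nonempty with rfl | hQ
  · simp
  obtain ⟨p, q, hp, hq, hpq⟩ := h P Q hP hQ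
  -- the matrix `b` placed in the upper right corner
  let E : Matrix F₁ F₂ ℂ → Matrix (ULift.{u} (P ⊕ Q)) (ULift.{u} (P ⊕ Q)) ℂ := fun b =>
    Matrix.of fun i j => Sum.elim (fun s : P => Sum.elim (fun _ : P => 0) (fun t : Q => b s t) j.down)
      (fun _ : Q => 0) i.down
  have hE (b : Matrix F₁ F₂ ℂ) (v : EuclideanSpace ℂ (ULift.{u} (P ⊕ Q))) :
      ‖Matrix.toEuclideanCLM (𝕜 := ℂ) (E b) v‖ ^ 2
        = ∑ s : P, ‖∑ t : Q, b s t * v ⟨.inr t⟩‖ ^ 2 := by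
    rw [EuclideanSpace.norm_sq_eq, Matrix.ofLp_toEuclideanCLM,
      ← Equiv.ulift.symm.sum_comp, Fintype.sum_sum_type]
    have hE' (i) : (E b *ᵥ v.ofLp) i = ∑ j : P ⊕ Q, E b i ⟨j⟩ * v ⟨j⟩ :=
      (Equiv.ulift.symm.sum_comp fun j => E b i j * v j).symm
    simp [hE', E]
  set r : Matrix F₁ F₂ ℂ := Matrix.of fun s t => a s t / ((s : ℂ) - t) with hr
  have h1 : (Matrix.of fun i j => (f (p i) - f (q j)) * E r i j)
      = E (dividedDifference₀ f F₁ F₂ ⊙ a) := by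
    ext ⟨i⟩ ⟨j⟩
    rcases i with s | s <;> rcases j with t | t <;> simp only [E, Matrix.of_apply, Sum.elim_inl,
      Sum.elim_inr, mul_zero, hp, hq, Matrix.hadamard_apply, hr]
    rw [← dividedDifference₀_mul_sub]
    by_cases hst : ((s : F₁) : ℂ) = (t : F₂)
    · simp [dividedDifference₀_of_eq f _ _ hst]
    · have := sub_ne_zero.2 hst
      field_simp
  have h2 : (Matrix.of fun i j => (p i - q j) * E r i j) = E a := by
    ext ⟨i⟩ ⟨j⟩
    rcases i with s | s <;> rcases j with t | t <;> simp only [E, Matrix.of_apply, Sum.elim_inl,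
      Sum.elim_inr, mul_zero, hp, hq, hr]
    by_cases hst : ((s : F₁) : ℂ) = (t : F₂)
    · simp [h0 _ _ hst]
    · have := sub_ne_zero.2 hst
      field_simp
  have hEA : ‖Matrix.toEuclideanCLM (𝕜 := ℂ) (E a)‖ ≤ ‖A‖ := by
    refine ContinuousLinearMap.opNorm_le_bound _ (norm_nonneg _) fun v => ?_
    rw [← sq_le_sq₀ (by positivity) (by positivity), hE, mul_pow, EuclideanSpace.norm_sq_eq]
    let y : F₂ → ℂ := fun t => if ht : t ∈ Q then v ⟨.inr ⟨t, ht⟩⟩ else 0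
    have hy (t : Q) : y t = v ⟨.inr t⟩ := by simp [y]
    calc ∑ s : P, ‖∑ t : Q, a s t * v ⟨.inr t⟩‖ ^ 2
        = ∑ s ∈ P, ‖A (∑ t ∈ Q, lp.single 2 t (y t)) s‖ ^ 2 := by
          rw [← Finset.sum_coe_sort P]
          refine Finset.sum_congr rfl fun s _ => ?_
          rw [hA.apply_sum_single, ← Finset.sum_coe_sort Q]
          simp only [hy]
      _ ≤ ‖A (∑ t ∈ Q, lp.single 2 t (y t))‖ ^ 2 := sum_sq_le_norm_sq _ _
      _ ≤ (‖A‖ * ‖(∑ t ∈ Q, lp.single 2 t (y t) : ℓ²(F₂, ℂ))‖) ^ 2 := by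
          gcongr
          exact A.le_opNorm _
      _ = ‖A‖ ^ 2 * ∑ t : Q, ‖v ⟨.inr t⟩‖ ^ 2 := by
          rw [mul_pow, norm_sq_sum_single, ← Finset.sum_coe_sort Q]
          simp only [hy]
      _ ≤ ‖A‖ ^ 2 * ∑ i, ‖v i‖ ^ 2 := by
          gcongr
          rw [← Equiv.ulift.symm.sum_comp, Fintype.sum_sum_type]
          exact le_add_of_nonneg_left (Finset.sum_nonneg fun _ _ => by positivity)
  have hB : ‖Matrix.toEuclideanCLM (𝕜 := ℂ) (E (dividedDifference₀ f F₁ F₂ ⊙ a))‖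
      ≤ C * ‖A‖ := by
    rw [← h1]
    refine (hpq (E r)).trans ?_
    rw [h2]
    gcongr
  let v : EuclideanSpace ℂ (ULift.{u} (P ⊕ Q)) :=
    WithLp.toLp 2 fun i => Sum.elim (fun _ => 0) (fun t : Q => x t) i.down
  have hv : ‖v‖ ^ 2 = ∑ t ∈ Q, ‖x t‖ ^ 2 := by
    rw [EuclideanSpace.norm_sq_eq, ← Equiv.ulift.symm.sum_comp, Fintype.sum_sum_type,
      ← Finset.sum_coe_sort Q]
    simp [v]
  have hfin : ‖Matrix.toEuclideanCLM (𝕜 := ℂ) (E (dividedDifference₀ f F₁ F₂ ⊙ a)) v‖ ^ 2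
      ≤ (C * ‖A‖ * ‖v‖) ^ 2 := by
    gcongr
    exact ContinuousLinearMap.le_of_opNorm_le _ hB v
  rw [hE, mul_pow, hv, Finset.sum_coe_sort P
    fun s => ‖∑ t : Q, (dividedDifference₀ f F₁ F₂ ⊙ a) s t * v ⟨.inr t⟩‖ ^ 2] at hfin
  refine le_trans (le_of_eq ?_) hfin
  refine Finset.sum_congr rfl fun s _ => ?_
  rw [← Finset.sum_coe_sort Q]
  rfl

theorem PairBound.offDiagonalBound {F₁ F₂ : Set ℂ} {f : ℂ → ℂ} {C : ℝ≥0}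
    (h : PairBound.{u} F₁ F₂ f C) : OffDiagonalBound (dividedDifference₀ f F₁ F₂) C := by
  classical
  refine offDiagonalBound_of_diagonalBound.{u} fun P Q hP hQ => ?_
  obtain ⟨s₀, -⟩ := hP
  obtain ⟨t₀, -⟩ := hQ
  refine ⟨fun i => Sum.elim (fun s : P => ((s : F₁) : ℂ)) (fun _ : Q => s₀) i.down,
    fun i => Sum.elim (fun _ : P => (t₀ : ℂ)) (fun t : Q => ((t : F₂) : ℂ)) i.down, fun _ => rfl,
    fun _ => rfl, h.diagonalBound ?_ ?_⟩
  · rintro ⟨s | t⟩ <;> simp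
  · rintro ⟨s | t⟩ <;> simp

theorem CommutatorBound.offDiagonalBound {F : Set ℂ} {f : ℂ → ℂ} {C : ℝ≥0}
    (h : CommutatorBound.{u} F f C) : OffDiagonalBound (dividedDifference₀ f F F) C := by
  classical
  refine offDiagonalBound_of_diagonalBound.{u} fun P Q _ _ => ?_
  refine ⟨fun i => Sum.elim (fun s : P => ((s : F) : ℂ)) (fun t : Q => ((t : F) : ℂ)) i.down, _,
    fun _ => rfl, fun _ => rfl, h.diagonalBound ?_⟩
  rintro ⟨s | t⟩ <;> simp

end CommutatorLipschitz

/-! ### Approximate diagonalization of normal operators -/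

namespace CommutatorLipschitz

open SchurMultiplier Filter Topology

section Normal

variable {H : Type*} [NormedAddCommGroup H] [InnerProductSpace ℂ H] [CompleteSpace H]

theorem norm_sq_cfc_apply {N : H →L[ℂ] H} [IsStarNormal N] {k : ℂ → ℂ}
    (hk : ContinuousOn k (spectrum ℂ N)) (y : H) :
    ((‖cfc k N y‖ ^ 2 : ℝ) : ℂ) = inner ℂ y (cfc (fun w => star (k w) * k w) N y) := by
  rw [cfc_mul (fun w => star (k w)) k N hk.star hk, cfc_star, mul_apply_eq_comp,
    ContinuousLinearMap.star_eq_adjoint, ContinuousLinearMap.adjoint_inner_right]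
  simp

theorem sum_norm_sq_cfc_apply_eq {τ : Type*} (N : H →L[ℂ] H) [IsStarNormal N] {P : Finset τ}
    {k : τ → ℂ → ℂ} (hk : ∀ t ∈ P, ContinuousOn (k t) (spectrum ℂ N)) (y : H) :
    ((∑ t ∈ P, ‖cfc (k t) N y‖ ^ 2 : ℝ) : ℂ)
      = inner ℂ y (cfc (∑ t ∈ P, fun w => star (k t w) * k t w) N y) := by
  rw [cfc_sum (fun t w => star (k t w) * k t w) N P fun t ht => (hk t ht).star.mul (hk t ht),
    sum_apply, inner_sum, Complex.ofReal_sum]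
  exact Finset.sum_congr rfl fun t ht => norm_sq_cfc_apply (hk t ht) y

theorem sum_norm_sq_cfc_apply_le {τ : Type*} (N : H →L[ℂ] H) [IsStarNormal N] {P : Finset τ}
    {k : τ → ℂ → ℂ} (hk : ∀ t ∈ P, ContinuousOn (k t) (spectrum ℂ N)) {c : ℝ}
    (hc : ∀ w ∈ spectrum ℂ N, ∑ t ∈ P, ‖k t w‖ ^ 2 ≤ c ^ 2) (y : H) :
    ∑ t ∈ P, ‖cfc (k t) N y‖ ^ 2 ≤ c ^ 2 * ‖y‖ ^ 2 := by
  have h0 : 0 ≤ ∑ t ∈ P, ‖cfc (k t) N y‖ ^ 2 := Finset.sum_nonneg fun _ _ => by positivity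
  have h1 := congrArg norm (sum_norm_sq_cfc_apply_eq N hk y)
  rw [Complex.norm_real, Real.norm_of_nonneg h0] at h1
  rw [h1]
  have h2 : ‖cfc (∑ t ∈ P, fun w => star (k t w) * k t w) N‖ ≤ c ^ 2 :=
    norm_cfc_le (by positivity) fun w hw => by
      rw [Finset.sum_apply]
      refine (norm_sum_le _ _).trans (le_trans (le_of_eq ?_) (hc w hw))
      exact Finset.sum_congr rfl fun t _ => by rw [norm_mul, norm_star, sq]
  calc _ ≤ ‖y‖ * ‖cfc (∑ t ∈ P, fun w => star (k t w) * k t w) N y‖ := norm_inner_le_norm _ _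
    _ ≤ ‖y‖ * (c ^ 2 * ‖y‖) := by
        gcongr
        exact ContinuousLinearMap.le_of_opNorm_le _ h2 y
    _ = _ := by ring

/-- The row operator with entries `k t (N)` is the adjoint of a column operator, whose norm is
computed by the functional calculus. -/
theorem norm_sum_cfc_apply_le {τ : Type*} (N : H →L[ℂ] H) [IsStarNormal N] {P : Finset τ}
    {k : τ → ℂ → ℂ} (hk : ∀ t ∈ P, ContinuousOn (k t) (spectrum ℂ N)) {c : ℝ} (hc0 : 0 ≤ c)
    (hc : ∀ w ∈ spectrum ℂ N, ∑ t ∈ P, ‖k t w‖ ^ 2 ≤ c ^ 2) (v : τ → H) :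
    ‖∑ t ∈ P, cfc (k t) N (v t)‖ ≤ c * √(∑ t ∈ P, ‖v t‖ ^ 2) := by
  set z := ∑ t ∈ P, cfc (k t) N (v t) with hz
  have hcol := sum_norm_sq_cfc_apply_le N (k := fun t w => star (k t w))
    (fun t ht => (hk t ht).star) (by simpa using hc) z
  have h1 : ‖z‖ * ‖z‖ ≤ ‖z‖ * (c * √(∑ t ∈ P, ‖v t‖ ^ 2)) := by
    calc ‖z‖ * ‖z‖ = ‖inner ℂ z z‖ := by simp [inner_self_eq_norm_sq_to_K, sq]
      _ = ‖∑ t ∈ P, inner ℂ (cfc (fun w => star (k t w)) N z) (v t)‖ := by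
          conv_lhs => rw [hz, ← hz, inner_sum]
          simp only [cfc_star, ContinuousLinearMap.star_eq_adjoint,
            ContinuousLinearMap.adjoint_inner_left]
      _ ≤ ∑ t ∈ P, ‖cfc (fun w => star (k t w)) N z‖ * ‖v t‖ :=
          (norm_sum_le _ _).trans (Finset.sum_le_sum fun t _ => norm_inner_le_norm _ _)
      _ ≤ √(∑ t ∈ P, ‖cfc (fun w => star (k t w)) N z‖ ^ 2) * √(∑ t ∈ P, ‖v t‖ ^ 2) :=
          Real.sum_mul_le_sqrt_mul_sqrt _ _ _
      _ ≤ √(c ^ 2 * ‖z‖ ^ 2) * √(∑ t ∈ P, ‖v t‖ ^ 2) := by gcongr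
      _ = ‖z‖ * (c * √(∑ t ∈ P, ‖v t‖ ^ 2)) := by
          rw [← mul_pow, Real.sqrt_sq (by positivity)]; ring
  rcases (norm_nonneg z).eq_or_lt with h0 | h0
  · rw [← h0]; positivity
  · exact le_of_mul_le_mul_left h1 h0

/-- The operator `ℓ²(F) → H` that sends the basis vector at `t` to `k t (N) (v t)` if `t ∈ P`, and
to `0` otherwise. -/
noncomputable def synthesis {F : Set ℂ} (P : Finset F) (k : F → ℂ → ℂ) (N : H →L[ℂ] H)
    (v : F → H) : ℓ²(F, ℂ) →L[ℂ] H :=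
  ∑ t ∈ P, (lp.evalCLM ℂ (fun _ : F => ℂ) 2 t).smulRight (cfc (k t) N (v t))

theorem synthesis_apply {F : Set ℂ} (P : Finset F) (k : F → ℂ → ℂ) (N : H →L[ℂ] H) (v : F → H)
    (ξ : ℓ²(F, ℂ)) : synthesis P k N v ξ = ∑ t ∈ P, ξ t • cfc (k t) N (v t) := by
  rw [synthesis, sum_apply]
  rfl

theorem norm_synthesis_le {F : Set ℂ} {P : Finset F} {k : F → ℂ → ℂ} (N : H →L[ℂ] H)
    [IsStarNormal N] {v : F → H} (hv : ∀ t, ‖v t‖ ≤ 1)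
    (hk : ∀ t ∈ P, ContinuousOn (k t) (spectrum ℂ N)) {c : ℝ} (hc0 : 0 ≤ c)
    (hc : ∀ w ∈ spectrum ℂ N, ∑ t ∈ P, ‖k t w‖ ^ 2 ≤ c ^ 2) :
    ‖synthesis P k N v‖ ≤ c := by
  refine ContinuousLinearMap.opNorm_le_bound _ hc0 fun ξ => ?_
  rw [synthesis_apply]
  simp only [← map_smul]
  refine (norm_sum_cfc_apply_le N hk hc0 hc _).trans ?_
  gcongr
  refine Real.sqrt_le_iff.2 ⟨norm_nonneg _, le_trans ?_ (sum_sq_le_norm_sq ξ P)⟩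
  gcongr with t ht
  rw [norm_smul]
  exact mul_le_of_le_one_right (norm_nonneg _) (hv t)

/-- A compact set carries a finite continuous partition of unity, in the form `∑ g_t² = 1`, with
`g_t` supported in the `δ`-ball around the point `t` of the set. -/
theorem exists_sq_partition {F K : Set ℂ} (hK : IsCompact K) (hKF : K ⊆ F) {δ : ℝ} (hδ : 0 < δ) :
    ∃ (P : Finset F) (g : F → ℂ → ℝ), (∀ t ∈ P, (t : ℂ) ∈ K) ∧ (∀ t, ContinuousOn (g t) K) ∧
      (∀ w ∈ K, ∑ t ∈ P, g t w ^ 2 = 1) ∧ ∀ t w, g t w ≠ 0 → dist w t < δ := by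
  obtain ⟨P₀, hP₀⟩ := hK.elim_finite_subcover (fun t : K => Metric.ball (t : ℂ) δ)
    (fun _ => Metric.isOpen_ball)
    fun w hw => Set.mem_iUnion.2 ⟨⟨w, hw⟩, Metric.mem_ball_self hδ⟩
  let P : Finset F := P₀.map (Set.embeddingOfSubset K F hKF)
  let h : F → ℂ → ℝ := fun t w => max 0 (δ - dist w t)
  have hcont (t : F) : Continuous (h t) := by fun_prop
  have hpos : ∀ w ∈ K, 0 < ∑ t ∈ P, h t w ^ 2 := fun w hw => by
    obtain ⟨t, ht, hwt⟩ := Set.mem_iUnion₂.1 (hP₀ hw)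
    refine Finset.sum_pos' (fun _ _ => by positivity)
      ⟨Set.embeddingOfSubset K F hKF t, Finset.mem_map_of_mem _ ht, ?_⟩
    have : 0 < δ - dist w t := sub_pos.2 (Metric.mem_ball.1 hwt)
    have : 0 < h (Set.embeddingOfSubset K F hKF t) w := lt_max_of_lt_right this
    positivity
  refine ⟨P, fun t w => h t w / √(∑ t ∈ P, h t w ^ 2), ?_, fun t => ?_, fun w hw => ?_,
    fun t w hne => ?_⟩
  · intro t ht
    obtain ⟨t', -, rfl⟩ := Finset.mem_map.1 ht
    exact t'.2
  · refine (hcont t).continuousOn.div (Continuous.continuousOn ?_)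
      fun w hw => (Real.sqrt_pos.2 (hpos w hw)).ne'
    exact Real.continuous_sqrt.comp (continuous_finsetSum _ fun t _ => (hcont t).pow 2)
  · simp only [div_pow, Real.sq_sqrt (hpos w hw).le]
    rw [← Finset.sum_div, div_self (hpos w hw).ne']
  · by_contra! hle
    exact hne (by simp [h, hle])

open Classical in
/-- A vector `x` lies in the range of a contraction `U : ℓ²(F) → H` that almost intertwines the
diagonal operators on `ℓ²(F)` with the functional calculus of the normal operator `N`. This takes
the place of a spectral resolution of `x`: with a partition of unity `∑ g_t² = 1` on the spectrum,
`U` sends the basis vector at `t` to `g_t(N) u_t`, where `u_t` is the unit vector in the direction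
of `g_t(N) x`. -/
theorem exists_almost_intertwining {F : Set ℂ} (N : H →L[ℂ] H) [IsStarNormal N]
    (hN : spectrum ℂ N ⊆ F) {δ : ℝ} (hδ : 0 < δ) (x : H) :
    ∃ (U : ℓ²(F, ℂ) →L[ℂ] H) (ξ : ℓ²(F, ℂ)), ‖U‖ ≤ 1 ∧ ‖ξ‖ = ‖x‖ ∧ U ξ = x ∧
      ∀ (φ : ℂ → ℂ) (ε : ℝ), ContinuousOn φ (spectrum ℂ N) → 0 ≤ ε →
        (∀ w ∈ spectrum ℂ N, ∀ t ∈ spectrum ℂ N, dist w t < δ → dist (φ w) (φ t) ≤ ε) →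
        ∃ Uφ : ℓ²(F, ℂ) →L[ℂ] H,
          (∀ t : F, Uφ (lp.single 2 t 1) = φ t • U (lp.single 2 t 1)) ∧
          ‖(cfc φ N).comp U - Uφ‖ ≤ ε := by
  obtain ⟨P, g, hPN, hg, hg1, hgδ⟩ := exists_sq_partition (spectrum.isCompact N) hN hδ
  have hgc (t : F) : ContinuousOn (fun w => (g t w : ℂ)) (spectrum ℂ N) :=
    Complex.continuous_ofReal.comp_continuousOn (hg t)
  have hgn : ∀ w ∈ spectrum ℂ N, ∑ t ∈ P, ‖(g t w : ℂ)‖ ^ 2 = 1 := fun w hw => by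
    rw [← hg1 w hw]; simp
  have hone : cfc (∑ t ∈ P, fun w => (g t w : ℂ) * g t w) N = 1 := by
    rw [← cfc_const_one ℂ N]
    refine cfc_congr fun w hw => ?_
    rw [Finset.sum_apply]
    have := hg1 w hw
    simp only [sq] at this
    exact_mod_cast this
  let xt : F → H := fun t => cfc (fun w => (g t w : ℂ)) N x
  -- a junk value: `v t = 0` where `xt t = 0`
  let v : F → H := fun t => (‖xt t‖⁻¹ : ℂ) • xt t
  have hv (t : F) : ‖v t‖ ≤ 1 := by
    simp only [v, norm_smul, norm_inv, Complex.norm_real, norm_norm]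
    exact inv_mul_le_one
  have hvx (t : F) : (‖xt t‖ : ℂ) • v t = xt t := by
    rcases eq_or_ne (xt t) 0 with h0 | h0
    · simp [v, h0]
    · have : (‖xt t‖ : ℂ) ≠ 0 := by simpa using h0
      simp [v, this]
  have hsum : ∑ t ∈ P, ‖xt t‖ ^ 2 = ‖x‖ ^ 2 := by
    have h := sum_norm_sq_cfc_apply_eq N (P := P) (fun t _ => hgc t) x
    simp only [RCLike.star_def, Complex.conj_ofReal] at h
    rw [hone, one_apply_eq_self, inner_self_eq_norm_sq_to_K] at h
    exact Complex.ofReal_injective (h.trans (by simp))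
  refine ⟨synthesis P (fun t w => (g t w : ℂ)) N v,
    ∑ t ∈ P, lp.single 2 t (‖xt t‖ : ℂ), ?_, ?_, ?_, ?_⟩
  · exact norm_synthesis_le N hv (fun t _ => hgc t) zero_le_one fun w hw => by
      rw [hgn w hw, one_pow]
  · rw [← sq_eq_sq₀ (norm_nonneg _) (norm_nonneg _), norm_sq_sum_single, ← hsum]
    simp
  · have h1 : ∑ t ∈ P, cfc (fun w => (g t w : ℂ) * g t w) N x = x := by
      rw [cfc_sum (fun t w => (g t w : ℂ) * g t w) N P
        fun t _ => (hgc t).mul (hgc t)] at hone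
      rw [← sum_apply, hone, one_apply_eq_self]
    rw [synthesis_apply]
    conv_rhs => rw [← h1]
    refine Finset.sum_congr rfl fun t ht => ?_
    rw [coeFn_sum_single_of_mem _ ht, ← map_smul, hvx, cfc_mul _ _ N (hgc t) (hgc t)]
    rfl
  · intro φ ε hφ hε hφε
    refine ⟨synthesis P (fun t w => φ t * g t w) N v, fun t => ?_, ?_⟩
    · rw [synthesis_apply, synthesis_apply, Finset.smul_sum]
      refine Finset.sum_congr rfl fun s _ => ?_
      rcases eq_or_ne s t with rfl | hst
      · rw [cfc_const_mul (φ s) _ N (hgc s)]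
        simp
      · simp [lp.single_apply, hst]
    · have hsub : (cfc φ N).comp (synthesis P (fun t w => (g t w : ℂ)) N v)
          - synthesis P (fun t w => φ t * g t w) N v
          = synthesis P (fun t w => (φ w - φ t) * g t w) N v := by
        ext ξ
        simp only [sub_apply, ContinuousLinearMap.comp_apply, synthesis_apply,
          map_sum, ← Finset.sum_sub_distrib]
        refine Finset.sum_congr rfl fun t _ => ?_
        rw [map_smul, ← smul_sub, ← mul_apply_eq_comp, ← cfc_mul _ _ N hφ (hgc t),
          ← sub_apply, ← cfc_sub (fun w => φ w * g t w)
            (fun w => φ t * g t w) N (hφ.mul (hgc t)) (continuousOn_const.mul (hgc t))]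
        simp only [sub_mul]
      rw [hsub]
      refine norm_synthesis_le N hv
        (fun t _ => (hφ.sub continuousOn_const).mul (hgc t)) hε fun w hw => ?_
      calc ∑ t ∈ P, ‖(φ w - φ t) * g t w‖ ^ 2
          ≤ ∑ t ∈ P, ε ^ 2 * ‖(g t w : ℂ)‖ ^ 2 := by
            refine Finset.sum_le_sum fun t ht => ?_
            rw [norm_mul, mul_pow]
            by_cases h0 : g t w = 0
            · simp [h0]
            · gcongr
              rw [← dist_eq_norm]
              exact hφε w hw t (hPN t ht) (hgδ t w h0)
        _ = ε ^ 2 := by rw [← Finset.mul_sum, hgn w hw, mul_one]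

/-! ### From Schur multipliers to commutator estimates -/

open ContinuousLinearMap in
/-- If `U` and `V` are contractions with `M₂ U ≈ Y` and `M₁† V ≈ W`, then compressing the commutator
of `M₁`, `M₂` with `R` by `U` and `V` gives approximately `W† R U - V† R Y`. -/
theorem norm_compression_sub_le {E₁ E₂ : Type*} [NormedAddCommGroup E₁] [InnerProductSpace ℂ E₁]
    [CompleteSpace E₁] [NormedAddCommGroup E₂] [InnerProductSpace ℂ E₂]
    {V W : E₁ →L[ℂ] H} {U Y : E₂ →L[ℂ] H} {M₁ M₂ R : H →L[ℂ] H} {ε : ℝ}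
    (hU : ‖U‖ ≤ 1) (hV : ‖V‖ ≤ 1) (hW : ‖(adjoint M₁).comp V - W‖ ≤ ε)
    (hY : ‖M₂.comp U - Y‖ ≤ ε) :
    ‖(adjoint V).comp ((M₁ * R - R * M₂).comp U)
      - ((adjoint W).comp (R.comp U) - (adjoint V).comp (R.comp Y))‖ ≤ 2 * ε * ‖R‖ := by
  have h1 : (adjoint V).comp ((M₁ * R - R * M₂).comp U)
      - ((adjoint W).comp (R.comp U) - (adjoint V).comp (R.comp Y))
      = (adjoint ((adjoint M₁).comp V - W)).comp (R.comp U)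
        - (adjoint V).comp (R.comp (M₂.comp U - Y)) := by
    rw [map_sub, adjoint_comp, adjoint_adjoint]
    ext ξ
    simp only [sub_apply, comp_apply, mul_apply_eq_comp, map_sub]
    abel
  have hε : 0 ≤ ε := (norm_nonneg _).trans hW
  rw [h1]
  refine (norm_sub_le _ _).trans ?_
  calc _ ≤ ε * (‖R‖ * 1) + 1 * (‖R‖ * ε) := by
        gcongr
        · refine (opNorm_comp_le _ _).trans ?_
          rw [LinearIsometryEquiv.norm_map]
          gcongr
          exact (opNorm_comp_le _ _).trans (by gcongr)
        · refine (opNorm_comp_le _ _).trans ?_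
          rw [LinearIsometryEquiv.norm_map]
          gcongr
          exact (opNorm_comp_le _ _).trans (by gcongr)
    _ = 2 * ε * ‖R‖ := by ring

open ContinuousLinearMap Classical in
/-- If `W e_s = conj (φ s) V e_s` and `Y e_t = φ t U e_t` on the basis vectors, then
`W† R U - V† R Y` has the matrix `(φ s - φ t) ⟨V e_s, R U e_t⟩`. -/
theorem induces_compression {F₁ F₂ : Set ℂ} {φ : ℂ → ℂ} {V W : ℓ²(F₁, ℂ) →L[ℂ] H}
    {U Y : ℓ²(F₂, ℂ) →L[ℂ] H} (R : H →L[ℂ] H)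
    (hW : ∀ s : F₁, W (lp.single 2 s 1) = star (φ s) • V (lp.single 2 s 1))
    (hY : ∀ t : F₂, Y (lp.single 2 t 1) = φ t • U (lp.single 2 t 1)) :
    Induces (Matrix.of fun (s : F₁) (t : F₂) =>
        (φ s - φ t) * inner ℂ (V (lp.single 2 s 1)) (R (U (lp.single 2 t 1))))
      ((adjoint W).comp (R.comp U) - (adjoint V).comp (R.comp Y)) := by
  convert induces_matrix _ using 1
  ext s t
  have hcoord (z : ℓ²(F₁, ℂ)) : z s = inner ℂ (lp.single 2 s 1 : ℓ²(F₁, ℂ)) z := by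
    simp [lp.inner_single_left]
  rw [Matrix.of_apply, Matrix.of_apply, hcoord]
  simp only [sub_apply, comp_apply, inner_sub_right, adjoint_inner_right, hW, hY, map_smul,
    inner_smul_left, inner_smul_right]
  simp [sub_mul]

open ContinuousLinearMap in
/-- The commutator estimate up to an error that vanishes as `ε → 0`: compress to `ℓ²` by almost
intertwining contractions and apply the Schur multiplier bound there. -/
theorem norm_inner_commutator_le {F₁ F₂ : Set ℂ} {f : ℂ → ℂ} {C : ℝ≥0}
    (h : OffDiagonalBound (dividedDifference₀ f F₁ F₂) C) (hf : ContinuousOn f (F₁ ∪ F₂))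
    (N₁ N₂ R : H →L[ℂ] H) [IsStarNormal N₁] [IsStarNormal N₂] (hN₁ : spectrum ℂ N₁ ⊆ F₁)
    (hN₂ : spectrum ℂ N₂ ⊆ F₂) (x y : H) {ε : ℝ} (hε : 0 < ε) :
    ‖inner ℂ y ((cfc f N₁ * R - R * cfc f N₂) x)‖
      ≤ (C * (‖N₁ * R - R * N₂‖ + 2 * ε * ‖R‖) + 2 * ε * ‖R‖) * ‖x‖ * ‖y‖ := by
  have hf₁ : ContinuousOn f (spectrum ℂ N₁) := hf.mono (hN₁.trans Set.subset_union_left)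
  have hf₂ : ContinuousOn f (spectrum ℂ N₂) := hf.mono (hN₂.trans Set.subset_union_right)
  obtain ⟨δ₁, hδ₁, hu₁⟩ := Metric.uniformContinuousOn_iff_le.1
    ((spectrum.isCompact N₁).uniformContinuousOn_of_continuous hf₁) ε hε
  obtain ⟨δ₂, hδ₂, hu₂⟩ := Metric.uniformContinuousOn_iff_le.1
    ((spectrum.isCompact N₂).uniformContinuousOn_of_continuous hf₂) ε hε
  obtain ⟨V, η, hV, hη, hVη, hVφ⟩ :=
    exists_almost_intertwining N₁ hN₁ (lt_min hδ₁ hε) y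
  obtain ⟨U, ξ, hU, hξ, hUξ, hUφ⟩ :=
    exists_almost_intertwining N₂ hN₂ (lt_min hδ₂ hε) x
  obtain ⟨V₁, hV₁, hV₁ε⟩ := hVφ (fun w => star (id w)) ε (by fun_prop) hε.le fun w _ t _ hwt => by
    simpa [dist_eq_norm, ← map_sub] using (hwt.trans_le (min_le_right _ _)).le
  obtain ⟨V₂, hV₂, hV₂ε⟩ := hVφ (fun w => star (f w)) ε hf₁.star hε.le fun w hw t ht hwt => by
    simpa [dist_eq_norm, ← map_sub] using hu₁ w hw t ht (hwt.trans_le (min_le_left _ _)).le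
  obtain ⟨U₁, hU₁, hU₁ε⟩ := hUφ id ε continuousOn_id hε.le fun w _ t _ hwt =>
    (hwt.trans_le (min_le_right _ _)).le
  obtain ⟨U₂, hU₂, hU₂ε⟩ := hUφ f ε hf₂ hε.le fun w hw t ht hwt =>
    hu₂ w hw t ht (hwt.trans_le (min_le_left _ _)).le
  rw [cfc_star, cfc_id ℂ N₁, star_eq_adjoint] at hV₁ε
  rw [cfc_star, star_eq_adjoint] at hV₂ε
  rw [cfc_id ℂ N₂] at hU₁ε
  have hA := induces_compression R hV₁ hU₁
  have hB := induces_compression R hV₂ hU₂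
  obtain ⟨B, hB', hBC⟩ := h _ _ hA fun s t hst => by simp [hst]
  have hΦ : dividedDifference₀ f F₁ F₂ ⊙ (Matrix.of fun (s : F₁) (t : F₂) =>
      (id (s : ℂ) - id (t : ℂ)) * inner ℂ (V (lp.single 2 s 1)) (R (U (lp.single 2 t 1))))
      = Matrix.of fun (s : F₁) (t : F₂) =>
        (f s - f t) * inner ℂ (V (lp.single 2 s 1)) (R (U (lp.single 2 t 1))) := by
    ext s t
    simp only [Matrix.hadamard_apply, Matrix.of_apply, id_eq]
    rw [← mul_assoc, dividedDifference₀_mul_sub]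
  rw [hΦ] at hB'
  rw [hB'.unique hB] at hBC
  have hA' := norm_compression_sub_le (R := R) hU hV hV₁ε hU₁ε
  have hD' := norm_compression_sub_le (R := R) hU hV hV₂ε hU₂ε
  have hAle : ‖(adjoint V).comp ((N₁ * R - R * N₂).comp U)‖ ≤ ‖N₁ * R - R * N₂‖ := by
    refine (opNorm_comp_le _ _).trans ?_
    rw [LinearIsometryEquiv.norm_map]
    refine (mul_le_of_le_one_left (norm_nonneg _) hV).trans ?_
    exact (opNorm_comp_le _ _).trans (mul_le_of_le_one_right (norm_nonneg _) hU)
  have hin : inner ℂ y ((cfc f N₁ * R - R * cfc f N₂) x)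
      = inner ℂ η ((adjoint V).comp ((cfc f N₁ * R - R * cfc f N₂).comp U) ξ) := by
    rw [comp_apply, adjoint_inner_right, hVη, comp_apply, hUξ]
  have hAn : ‖(adjoint V₁).comp (R.comp U) - (adjoint V).comp (R.comp U₁)‖
      ≤ ‖N₁ * R - R * N₂‖ + 2 * ε * ‖R‖ :=
    (norm_le_norm_add_norm_sub _ _).trans (add_le_add hAle hA')
  have hDn : ‖(adjoint V).comp ((cfc f N₁ * R - R * cfc f N₂).comp U)‖
      ≤ C * (‖N₁ * R - R * N₂‖ + 2 * ε * ‖R‖) + 2 * ε * ‖R‖ :=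
    (norm_le_norm_add_norm_sub' _ _).trans
      (add_le_add (hBC.trans (mul_le_mul_of_nonneg_left hAn C.coe_nonneg)) hD')
  rw [hin, ← hξ, ← hη]
  refine (norm_inner_le_norm _ _).trans ?_
  rw [mul_comm ‖η‖]
  exact mul_le_mul_of_nonneg_right (le_of_opNorm_le _ hDn ξ) (norm_nonneg _)

end Normal

theorem _root_.SchurMultiplier.OffDiagonalBound.pairBound {F₁ F₂ : Set ℂ} {f : ℂ → ℂ} {C : ℝ≥0}
    (h : OffDiagonalBound (dividedDifference₀ f F₁ F₂) C) (hf : ContinuousOn f (F₁ ∪ F₂)) :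
    PairBound.{u} F₁ F₂ f C := by
  intro H _ _ _ N₁ N₂ R _ _ hN₁ hN₂
  -- the inner product of `D x` with itself recovers the norm of `D x`
  refine ContinuousLinearMap.opNorm_le_bound _ (by positivity) fun x => ?_
  set D := cfc f N₁ * R - R * cfc f N₂ with hD
  have hlim : ‖inner ℂ (D x) (D x)‖ ≤ C * ‖N₁ * R - R * N₂‖ * ‖x‖ * ‖D x‖ := by
    have ht : Tendsto (fun ε : ℝ =>
        (C * (‖N₁ * R - R * N₂‖ + 2 * ε * ‖R‖) + 2 * ε * ‖R‖) * ‖x‖ * ‖D x‖) (𝓝[>] 0)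
        (𝓝 (C * ‖N₁ * R - R * N₂‖ * ‖x‖ * ‖D x‖)) := by
      refine Tendsto.mono_left ?_ nhdsWithin_le_nhds
      refine Continuous.tendsto' (by fun_prop) _ _ (by simp)
    refine ge_of_tendsto ht ?_
    filter_upwards [self_mem_nhdsWithin] with ε hε
    exact norm_inner_commutator_le h hf N₁ N₂ R hN₁ hN₂ x (D x) hε
  rw [inner_self_eq_norm_sq_to_K, norm_pow, RCLike.norm_ofReal, abs_norm, sq] at hlim
  rcases (norm_nonneg (D x)).eq_or_lt with h0 | h0
  · rw [← h0]; positivity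
  · exact le_of_mul_le_mul_right hlim h0

theorem PairBound.commutatorBound {F : Set ℂ} {f : ℂ → ℂ} {C : ℝ≥0}
    (h : PairBound.{u} F F f C) : CommutatorBound.{u} F f C :=
  fun H _ _ _ N R hN hF => h H N N R hN hN hF hF

/-! ### The norms -/

/-- `f` is Lipschitz because the entries of `𝔇₀ f` are bounded. -/
theorem continuousOn_of_offDiagonalBound {F : Set ℂ} {f : ℂ → ℂ} {C : ℝ≥0}
    (h : OffDiagonalBound (dividedDifference₀ f F F) C) : ContinuousOn f F := by
  refine LipschitzOnWith.continuousOn (K := C) (LipschitzOnWith.of_dist_le_mul fun z hz w hw => ?_)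
  rcases eq_or_ne z w with rfl | hne
  · simp
  rw [dist_eq_norm, dist_eq_norm, ← dividedDifference₀_mul_sub f (⟨z, hz⟩ : F) (⟨w, hw⟩ : F),
    norm_mul]
  gcongr
  exact h.norm_apply_le hne

theorem pairBound_iff {F₁ F₂ : Set ℂ} {f : ℂ → ℂ} (hf : ContinuousOn f (F₁ ∪ F₂)) (C : ℝ≥0) :
    PairBound.{u} F₁ F₂ f C ↔ OffDiagonalBound (dividedDifference₀ f F₁ F₂) C :=
  ⟨fun h => h.offDiagonalBound, fun h => h.pairBound hf⟩

theorem commutatorBound_iff {F : Set ℂ} {f : ℂ → ℂ} (C : ℝ≥0) :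
    ContinuousOn f F ∧ CommutatorBound.{u} F f C
      ↔ OffDiagonalBound (dividedDifference₀ f F F) C :=
  ⟨fun h => h.2.offDiagonalBound, fun h =>
    have hf := continuousOn_of_offDiagonalBound h
    ⟨hf, (h.pairBound (by rwa [Set.union_self])).commutatorBound⟩⟩

theorem exists_offDiagonalBound_iff {F₁ F₂ : Set ℂ} (f : ℂ → ℂ) :
    (∃ C, OffDiagonalBound (dividedDifference₀ f F₁ F₂) C)
      ↔ IsSchurMultiplier (dividedDifference₀ f F₁ F₂) :=
  ⟨fun ⟨_, h⟩ => h.isSchurMultiplier (dividedDifference₀_of_eq f),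
    fun h => h.exists_offDiagonalBound⟩

theorem iInf_offDiagonalBound {X : Type*} {S T : Set X} (Φ : Matrix S T ℂ) :
    ⨅ (C : ℝ≥0) (_ : OffDiagonalBound Φ C), (C : ℝ≥0∞) = multiplierNorm₀ Φ := by
  refine le_antisymm ?_ (le_iInf₂ fun C hC => multiplierNorm₀_le_iff.2 hC)
  rcases eq_or_ne (multiplierNorm₀ Φ) ⊤ with htop | htop
  · simp [htop]
  lift multiplierNorm₀ Φ to ℝ≥0 using htop with C hC
  exact iInf₂_le C (multiplierNorm₀_le_iff.1 hC.ge)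

theorem pairNorm_eq {F₁ F₂ : Set ℂ} {f : ℂ → ℂ} (hf : ContinuousOn f (F₁ ∪ F₂)) :
    pairNorm.{u} F₁ F₂ f = multiplierNorm₀ (dividedDifference₀ f F₁ F₂) := by
  simp only [pairNorm, pairBound_iff hf, hf, true_and, iInf_offDiagonalBound]

theorem commNorm_eq (F : Set ℂ) (f : ℂ → ℂ) :
    commNorm.{u} F f = multiplierNorm₀ (dividedDifference₀ f F F) := by
  simp only [commNorm, commutatorBound_iff, iInf_offDiagonalBound]

end CommutatorLipschitz

theorem mainTheorem3 :
    (∀ (F₁ F₂ : Set ℂ) (_ : IsClosed F₁) (_ : IsClosed F₂)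
        (f : ℂ → ℂ) (_ : ContinuousOn f (F₁ ∪ F₂)),
      (CommutatorLipschitz.IsCommLipPair.{u} F₁ F₂ f ↔
        SchurMultiplier.IsSchurMultiplier (CommutatorLipschitz.dividedDifference₀ f F₁ F₂)) ∧
      CommutatorLipschitz.pairNorm.{u} F₁ F₂ f =
        SchurMultiplier.multiplierNorm₀ (CommutatorLipschitz.dividedDifference₀ f F₁ F₂) ∧
      SchurMultiplier.multiplierNorm₀ (CommutatorLipschitz.dividedDifference₀ f F₁ F₂) ≤
        SchurMultiplier.multiplierNorm (CommutatorLipschitz.dividedDifference₀ f F₁ F₂) ∧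
      SchurMultiplier.multiplierNorm (CommutatorLipschitz.dividedDifference₀ f F₁ F₂) ≤
        2 * CommutatorLipschitz.pairNorm.{u} F₁ F₂ f) ∧
    (∀ (F : Set ℂ) (_ : IsClosed F) (f : ℂ → ℂ),
      (CommutatorLipschitz.IsCommLip.{u} F f ↔
        SchurMultiplier.IsSchurMultiplier (CommutatorLipschitz.dividedDifference₀ f F F)) ∧
      CommutatorLipschitz.commNorm.{u} F f =
        SchurMultiplier.multiplierNorm₀ (CommutatorLipschitz.dividedDifference₀ f F F) ∧
      SchurMultiplier.multiplierNorm₀ (CommutatorLipschitz.dividedDifference₀ f F F) ≤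
        SchurMultiplier.multiplierNorm (CommutatorLipschitz.dividedDifference₀ f F F) ∧
      SchurMultiplier.multiplierNorm (CommutatorLipschitz.dividedDifference₀ f F F) ≤
        2 * CommutatorLipschitz.commNorm.{u} F f) := by
  refine ⟨fun F₁ F₂ _ _ f hf => ⟨?_, CommutatorLipschitz.pairNorm_eq hf,
    SchurMultiplier.multiplierNorm₀_le_multiplierNorm _, ?_⟩, fun F _ f => ⟨?_,
    CommutatorLipschitz.commNorm_eq F f, SchurMultiplier.multiplierNorm₀_le_multiplierNorm _, ?_⟩⟩
  · rw [← CommutatorLipschitz.exists_offDiagonalBound_iff]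
    simp only [CommutatorLipschitz.IsCommLipPair, CommutatorLipschitz.pairBound_iff hf, hf,
      true_and]
  · rw [CommutatorLipschitz.pairNorm_eq hf]
    exact SchurMultiplier.multiplierNorm_le_two_mul
      (CommutatorLipschitz.dividedDifference₀_of_eq f)
  · rw [← CommutatorLipschitz.exists_offDiagonalBound_iff]
    simp only [CommutatorLipschitz.IsCommLip, ← exists_and_left,
      CommutatorLipschitz.commutatorBound_iff]
  · rw [CommutatorLipschitz.commNorm_eq]
    exact SchurMultiplier.multiplierNorm_le_two_mul
      (CommutatorLipschitz.dividedDifference₀_of_eq f)
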